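/- For each $n\in\mathbb N$ let $f_n:\{0,1\}^n\times\{0,1\}^n\to\{0,1\}$ be a function and let $m=m(n)\ge 2$ be an integer. Let $\mathcal H=\ell^2(\mathbb N)$ be the single-mode Fock space with Fock basis $(|k\rangle)_{k\ge 0}$, and let $\hat N$ be the total photon number operator on $\mathcal H^{\otimes m}$, i.e. $\hat N|k_1,\dots,k_m\rangle=(k_1+\cdots+k_m)|k_1,\dots,k_m\rangle$. Consider a family of optical quantum simultaneous-message-passing (SMP) protocols $\Pi_n$ without shared resources: on input $x\in\{0,1\}^n$ Alice sends a density operator $\rho^{(n)}_x$ on $\mathcal H^{\otimes m(n)}$ to a Referee, on input $y\in\{0,1\}^n$ Bob sends a density operator $\sigma^{(n)}_y$ on $\mathcal H^{\otimes m(n)}$, and the Referee applies a two-outcome measurement $\{E_0,E_1\}$ (depending only on $n$) to $\rho^{(n)}_x\otimes\sigma^{(n)}_y$ and outputs the outcome. Suppose that for all $n,x,y$ the output differs from $f_n(x,y)$ with probability at most $1/3$, and that the maximum mean photon number $$\mu=\mu(n):=\max\Bigl(\{\operatorname{tr}(\hat N\rho^{(n)}_x):x\in\{0,1\}^n\}\cup\{\operatorname{tr}(\hat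 N\sigma^{(n)}_y):y\in\{0,1\}^n\}\Bigr)$$ is finite for every $n$. Let $Q^{||}_{1/3}(f_n)$ be the least total number of qubits that Alice and Bob send to the Referee in a qubit-based quantum SMP protocol without shared resources which computes $f_n$ with error at most $1/3$, and let $D(f_n)$ be the two-party deterministic communication complexity of $f_n$. Then, with $\delta=10^{-4}$, $$\min\{\mu\log m,\;m\log(1+\mu/\delta)\}=\Omega\bigl(Q^{||}_{1/3}(f_n)\bigr)$$ and $$\min\{\mu\log m,\;m\log(1+\mu/\delta)\}=\Omega\bigl(\log D(f_n)\bigr),$$ that is, there is an absolute constant $c>0$ (independent of $n$, of the functions $f_n$ and of the protocols) such that for every $n$ the left-hand side is at least $c\,Q^{||}_{1/3}(f_n)$, and at least $c\log D(f_n)$ whenever $D(f_n)\ge 1$. -/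

import Mathlib

open scoped ENNReal lp ComplexOrder Kronecker

noncomputable section

namespace OpticalComm

/-! ## Deterministic communication complexity -/

/-- A deterministic two-party protocol as a binary tree: at each inner node one of the parties
announces a bit which depends on her own input only, at each leaf the output is known. -/
inductive DetProtocol (X Y : Type) : Type where
  | output (b : Bool) : DetProtocol X Y
  | alice (bit : X → Bool) (zero one : DetProtocol X Y) : DetProtocol X Y
  | bob (bit : Y → Bool) (zero one : DetProtocol X Y) : DetProtocol X Y

namespace DetProtocol

variable {X Y : Type}

/-- The output of the protocol on the inputs `x`, `y`. -/
def run : DetProtocol X Y → X → Y → Bool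
  | output b, _, _ => b
  | alice bit zero one, x, y => if bit x then one.run x y else zero.run x y
  | bob bit zero one, x, y => if bit y then one.run x y else zero.run x y

/-- The number of bits communicated on the inputs `x`, `y`. -/
def costOn : DetProtocol X Y → X → Y → ℕ
  | output _, _, _ => 0
  | alice bit zero one, x, y => 1 + if bit x then one.costOn x y else zero.costOn x y
  | bob bit zero one, x, y => 1 + if bit y then one.costOn x y else zero.costOn x y

/-- The communication cost: the maximum over all inputs of the number of bits communicated. -/
def cost [Fintype X] [Fintype Y] (P : DetProtocol X Y) : ℕ :=
  Finset.univ.sup fun p : X × Y => P.costOn p.1 p.2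

end DetProtocol

/-- The deterministic communication complexity `D(f)`. -/
def detComplexity {X Y : Type} [Fintype X] [Fintype Y] (f : X → Y → Bool) : ℕ :=
  sInf {c | ∃ P : DetProtocol X Y, (∀ x y, P.run x y = f x y) ∧ P.cost = c}

/-! ## Qubit based quantum SMP protocols -/

/-- A density matrix of `a` qubits, indexed by the computational basis `{0,1}^a`. -/
structure QubitState (a : ℕ) where
  mat : Matrix (Fin a → Bool) (Fin a → Bool) ℂ
  posSemidef : mat.PosSemidef
  trace_eq_one : mat.trace = 1

/-- A quantum SMP protocol without shared resources, in which Alice sends `a` qubits and Bob sends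
`b` qubits; the Referee applies a general two-outcome measurement to the product state. -/
structure QubitSMP (X Y : Type) (a b : ℕ) where
  alice : X → QubitState a
  bob : Y → QubitState b
  referee : Bool → Matrix ((Fin a → Bool) × (Fin b → Bool)) ((Fin a → Bool) × (Fin b → Bool)) ℂ
  referee_posSemidef : ∀ r, (referee r).PosSemidef
  referee_sum : referee false + referee true = 1

namespace QubitSMP

variable {X Y : Type} {a b : ℕ}

/-- The probability `tr (E_r (ρ_x ⊗ σ_y))` that the Referee outputs `r` on the inputs `x`, `y`. -/
def outputProb (P : QubitSMP X Y a b) (x : X) (y : Y) (r : Bool) : ℝ :=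
  (P.referee r * ((P.alice x).mat ⊗ₖ (P.bob y).mat)).trace.re

/-- The protocol computes `f` with error at most `ε`. -/
def Computes (P : QubitSMP X Y a b) (f : X → Y → Bool) (ε : ℝ) : Prop :=
  ∀ x y, P.outputProb x y (!f x y) ≤ ε

end QubitSMP

/-- The quantum SMP communication complexity of `f` with error at most `ε`: the least total number
of qubits sent to the Referee. -/
def qubitSMPComplexity {X Y : Type} (f : X → Y → Bool) (ε : ℝ) : ℕ :=
  sInf {c | ∃ (a b : ℕ) (P : QubitSMP X Y a b), P.Computes f ε ∧ a + b = c}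

/-! ## Operators on the spaces `ℓ²(ι)` -/

section Hilbert

variable {ι κ : Type}

/-- The standard orthonormal basis of `ℓ²(ι)`. -/
def ket [DecidableEq ι] (i : ι) : ℓ²(ι, ℂ) := lp.single 2 i (1 : ℂ)

/-- The product vector `v ⊗ w` in `ℓ²(ι) ⊗ ℓ²(κ) = ℓ²(ι × κ)`. -/
def tensorVec (v : ℓ²(ι, ℂ)) (w : ℓ²(κ, ℂ)) : ℓ²(ι × κ, ℂ) :=
  ⟨fun p => v p.1 * w p.2, by
    have hv := (memℓp_gen_iff (p := 2) (by norm_num)).1 (lp.memℓp v)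
    have hw := (memℓp_gen_iff (p := 2) (by norm_num)).1 (lp.memℓp w)
    refine (memℓp_gen_iff (p := 2) (by norm_num)).2 ?_
    have h := hv.mul_of_nonneg hw (fun _ => by positivity) (fun _ => by positivity)
    refine h.congr fun p => ?_
    rw [norm_mul, Real.mul_rpow (norm_nonneg _) (norm_nonneg _)]⟩

/-- A density operator on `ℓ²(ι)`: a positive bounded operator of trace one. -/
structure DensityOperator (ι : Type) [DecidableEq ι] where
  op : ℓ²(ι, ℂ) →L[ℂ] ℓ²(ι, ℂ)
  isPositive : op.IsPositive
  hasSum_trace : HasSum (fun i => inner ℂ (ket i) (op (ket i))) 1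

/-- `tr (E (ρ ⊗ σ))`, evaluated in the product basis, on which `ρ ⊗ σ` acts by
`(ρ ⊗ σ) (e_i ⊗ e_j) = ρ e_i ⊗ σ e_j`. -/
def traceTensor [DecidableEq ι] [DecidableEq κ] (E : ℓ²(ι × κ, ℂ) →L[ℂ] ℓ²(ι × κ, ℂ))
    (ρ : DensityOperator ι) (σ : DensityOperator κ) : ℂ :=
  ∑' p : ι × κ, inner ℂ (ket p) (E (tensorVec (ρ.op (ket p.1)) (σ.op (ket p.2))))

end Hilbert

/-! ## Optical quantum SMP protocols -/

/-- The labels `(n_1, …, n_m)` of the Fock basis of `m` modes. The `m`-mode Fock space, the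
`m`-fold Hilbert tensor power of `ℓ²(ℕ)`, is `ℓ²(FockIndex m, ℂ)`. -/
abbrev FockIndex (m : ℕ) : Type := Fin m → ℕ

/-- The mean number of photons `tr (N ρ) = ∑ (n_1 + ⋯ + n_m) ⟨n_1, …, n_m| ρ |n_1, …, n_m⟩`
of an `m`-mode state; it may be infinite. -/
def meanPhotonNumber {m : ℕ} (ρ : DensityOperator (FockIndex m)) : ℝ≥0∞ :=
  ∑' k : FockIndex m,
    ((∑ i, k i : ℕ) : ℝ≥0∞) * ENNReal.ofReal (inner ℂ (ket k) (ρ.op (ket k))).re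

/-- An optical quantum SMP protocol without shared resources, in which Alice and Bob each send an
`m`-mode state; the Referee applies a general two-outcome measurement to the product state. -/
structure OpticalSMP (X Y : Type) (m : ℕ) where
  alice : X → DensityOperator (FockIndex m)
  bob : Y → DensityOperator (FockIndex m)
  referee : Bool →
    (ℓ²(FockIndex m × FockIndex m, ℂ) →L[ℂ] ℓ²(FockIndex m × FockIndex m, ℂ))
  referee_isPositive : ∀ r, (referee r).IsPositive
  referee_sum : referee false + referee true = 1

namespace OpticalSMP

variable {X Y : Type} {m : ℕ}

/-- The probability `tr (E_r (ρ_x ⊗ σ_y))` that the Referee outputs `r` on the inputs `x`, `y`. -/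
def outputProb (P : OpticalSMP X Y m) (x : X) (y : Y) (r : Bool) : ℝ :=
  (traceTensor (P.referee r) (P.alice x) (P.bob y)).re

/-- The protocol computes `f` with error at most `ε`. -/
def Computes (P : OpticalSMP X Y m) (f : X → Y → Bool) (ε : ℝ) : Prop :=
  ∀ x y, P.outputProb x y (!f x y) ≤ ε

/-- The maximum mean number of photons which Alice or Bob may have to send. -/
def maxMeanPhotonNumber (P : OpticalSMP X Y m) : ℝ≥0∞ :=
  max (⨆ x, meanPhotonNumber (P.alice x)) (⨆ y, meanPhotonNumber (P.bob y))

end OpticalSMP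

/-- The quantity `min {μ log m, m log (1 + μ / δ)}`. -/
def opticalCost (δ μ : ℝ) (m : ℕ) : ℝ :=
  min (μ * Real.log m) (m * Real.log (1 + μ / δ))

end OpticalComm

end

/-!
With `δ = 10⁻⁴` and `K = ⌊μ / δ⌋`, Markov's inequality shows that every state of the protocol has
weight at least `1 - δ` on the span of the basis vectors with at most `K` photons
(`le_trace_compress`). Cutting all states off there and normalizing them gives states of a space of
dimension `d`, where `d ≤ (m + 1) ^ K` and `d ≤ (K + 1) ^ m`, so that
`a = ⌈log₂ d⌉ = O(min {μ log m, m log (1 + μ / δ)})` qubits are enough for each party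
(`clog_card_boundedFock_le`). If `K = 0` then `d = 1` and no qubits are needed, so small `μ` is not
an exception.

The error of the truncated protocol is controlled by `trace_compress_le`: for `0 ≤ E ≤ 1` and a
projection `Π`, the inequality
`⟨Πw, EΠw⟩ ≤ (1 + t) ⟨w, Ew⟩ + (1 + 1/t) ‖w - Πw‖²` holds for every vector `w`, and summing it over
the vectors of a decomposition `ρ ⊗ σ = ∑ |w⟩⟨w|` bounds the new error by `0.36`. The decomposition
comes from a factorization `ρ = B* B`, and it also gives the absolute convergence that makes
`traceTensor` a genuine trace (`hasSum_inner_trace`). Taking the majority of three runs brings the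
error back to `1/3` (`exists_computes_of_error_le`), at the cost of `6 a` qubits in total, which
proves the bound for the quantum complexity.

For the deterministic complexity, a protocol with `q ≥ 1` qubits is simulated by letting Alice
announce the entries of her density matrix to precision `2 ^ (-O(q))`; Bob then knows the row of `f`.
This takes `2 ^ O(q)` bits (`log_detComplexity_le`), and if `q = 0` a single bit is enough.
-/

namespace OpticalComm

/-! ### Qubit protocols and the majority of three runs -/

/-- A protocol with states and measurements on arbitrary index types `A`, `B` of sizes `2 ^ a` and
`2 ^ b` is a qubit protocol with `a` and `b` qubits. -/
theorem exists_qubitSMP {X Y A B : Type} [Fintype A] [Fintype B] [DecidableEq A] [DecidableEq B]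
    {a b : ℕ} (eA : (Fin a → Bool) ≃ A) (eB : (Fin b → Bool) ≃ B)
    (ρ : X → Matrix A A ℂ) (hρ : ∀ x, (ρ x).PosSemidef) (hρ' : ∀ x, (ρ x).trace = 1)
    (σ : Y → Matrix B B ℂ) (hσ : ∀ y, (σ y).PosSemidef) (hσ' : ∀ y, (σ y).trace = 1)
    (E : Bool → Matrix (A × B) (A × B) ℂ) (hE : ∀ r, (E r).PosSemidef)
    (hE' : E false + E true = 1) :
    ∃ P : QubitSMP X Y a b, ∀ x y r,
      P.outputProb x y r = (E r * (ρ x ⊗ₖ σ y)).trace.re := by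
  have tr : ∀ {n m : Type} [Fintype n] [Fintype m] (e : n ≃ m) (M : Matrix m m ℂ),
      (M.submatrix e e).trace = M.trace := fun e M =>
    Equiv.sum_comp e fun i => M i i
  refine ⟨⟨fun x => ⟨(ρ x).submatrix eA eA, (hρ x).submatrix _, (tr _ _).trans (hρ' x)⟩,
    fun y => ⟨(σ y).submatrix eB eB, (hσ y).submatrix _, (tr _ _).trans (hσ' y)⟩,
    fun r => (E r).submatrix (eA.prodCongr eB) (eA.prodCongr eB), fun r => (hE r).submatrix _, ?_⟩,
    fun x y r => ?_⟩
  · exact (congrArg (fun M => M.submatrix (eA.prodCongr eB) (eA.prodCongr eB)) hE').trans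
      (Matrix.submatrix_one_equiv _)
  · have hk : (ρ x).submatrix eA eA ⊗ₖ (σ y).submatrix eB eB
        = (ρ x ⊗ₖ σ y).submatrix (eA.prodCongr eB) (eA.prodCongr eB) := rfl
    rw [QubitSMP.outputProb]
    simp only []
    rw [hk, Matrix.submatrix_mul_equiv, tr]

open scoped MatrixOrder in
theorem trace_mul_nonneg {n : Type*} [Fintype n] {E τ : Matrix n n ℂ}
    (hE : E.PosSemidef) (hτ : τ.PosSemidef) : 0 ≤ (E * τ).trace := by
  classical
  obtain ⟨B, rfl⟩ := CStarAlgebra.nonneg_iff_eq_star_mul_self.1 hτ.nonneg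
  rw [Matrix.star_eq_conjTranspose]
  rw [← Matrix.mul_assoc, Matrix.trace_mul_comm, ← Matrix.mul_assoc]
  exact (hE.mul_mul_conjTranspose_same B).trace_nonneg

/-- The rearrangement of factors under which the triple tensor power of a tensor product is the
tensor product of the triple tensor powers. -/
def tripleProdEquiv (A B : Type) : (A × A × A) × (B × B × B) ≃ (A × B) × (A × B) × (A × B) where
  toFun p := ((p.1.1, p.2.1), (p.1.2.1, p.2.2.1), (p.1.2.2, p.2.2.2))
  invFun q := ((q.1.1, q.2.1.1, q.2.2.1), (q.1.2, q.2.1.2, q.2.2.2))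
  left_inv _ := rfl
  right_inv _ := rfl

/-- The measurement which reports the majority of three independent measurements. The three terms
are the cases in which the first two outcomes are `r`, only the first and the third are `r`, and
only the last two are `r`. -/
def majority {n : Type} [DecidableEq n] (E : Bool → Matrix n n ℂ) (r : Bool) :
    Matrix (n × n × n) (n × n × n) ℂ :=
  E r ⊗ₖ (E r ⊗ₖ 1) + E r ⊗ₖ (E (!r) ⊗ₖ E r) + E (!r) ⊗ₖ (E r ⊗ₖ E r)

theorem majority_add {n : Type} [DecidableEq n] {E : Bool → Matrix n n ℂ}
    (hE : E false + E true = 1) : majority E false + majority E true = 1 := by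
  have h1 : ∀ r, E r ⊗ₖ (E (!r) ⊗ₖ E r) + E r ⊗ₖ (E (!r) ⊗ₖ E (!r))
      = E r ⊗ₖ (E (!r) ⊗ₖ (1 : Matrix n n ℂ)) := fun r => by
    rw [← Matrix.kronecker_add, ← Matrix.kronecker_add]
    cases r <;> simp [hE, add_comm (E true)]
  have h2 : ∀ r, E r ⊗ₖ (E r ⊗ₖ (1 : Matrix n n ℂ)) + E r ⊗ₖ (E (!r) ⊗ₖ (1 : Matrix n n ℂ))
      = E r ⊗ₖ ((1 : Matrix n n ℂ) ⊗ₖ (1 : Matrix n n ℂ)) := fun r => by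
    rw [← Matrix.kronecker_add, ← Matrix.add_kronecker]
    cases r <;> simp [hE, add_comm (E true)]
  calc majority E false + majority E true
      = (E false ⊗ₖ (E false ⊗ₖ 1) + (E false ⊗ₖ (E (!false) ⊗ₖ E false)
          + E false ⊗ₖ (E (!false) ⊗ₖ E (!false))))
        + (E true ⊗ₖ (E true ⊗ₖ 1) + (E true ⊗ₖ (E (!true) ⊗ₖ E true)
          + E true ⊗ₖ (E (!true) ⊗ₖ E (!true)))) := by
        simp only [majority, Bool.not_true, Bool.not_false]; abel
    _ = 1 := by
        rw [h1, h1, h2, h2, ← Matrix.add_kronecker, hE]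
        simp only [Matrix.one_kronecker_one]

theorem majority_posSemidef {n : Type} [Finite n] [DecidableEq n] {E : Bool → Matrix n n ℂ}
    (hE : ∀ r, (E r).PosSemidef) (r : Bool) : (majority E r).PosSemidef :=
  (((hE r).kronecker ((hE r).kronecker .one)).add
    ((hE r).kronecker ((hE _).kronecker (hE r)))).add
    ((hE _).kronecker ((hE r).kronecker (hE r)))

theorem trace_majority_mul {n : Type} [Fintype n] [DecidableEq n] (E : Bool → Matrix n n ℂ)
    (τ : Matrix n n ℂ) (r : Bool) :
    (majority E r * (τ ⊗ₖ (τ ⊗ₖ τ))).trace =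
      (E r * τ).trace ^ 2 * (τ.trace + 2 * (E (!r) * τ).trace) := by
  simp only [majority, add_mul, Matrix.trace_add, ← Matrix.mul_kronecker_mul,
    Matrix.trace_kronecker, one_mul]
  ring

/-- If the error is below `0.36`, three repetitions with a majority vote bring it below `1/3`. -/
theorem exists_computes_of_error_le {X Y : Type} {a b : ℕ} (P : QubitSMP X Y a b)
    {f : X → Y → Bool} (hP : P.Computes f (36 / 100)) :
    ∃ P' : QubitSMP X Y (3 * a) (3 * b), P'.Computes f (1 / 3) := by
  have equiv : ∀ a : ℕ, Nonempty ((Fin (3 * a) → Bool) ≃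
      (Fin a → Bool) × (Fin a → Bool) × (Fin a → Bool)) := fun a =>
    ⟨Fintype.equivOfCardEq (by simp [pow_mul']; ring)⟩
  obtain ⟨eA⟩ := equiv a
  obtain ⟨eB⟩ := equiv b
  have tr3 : ∀ {n : Type} [Fintype n] (M : Matrix n n ℂ), M.trace = 1 →
      (M ⊗ₖ (M ⊗ₖ M)).trace = 1 := fun M hM => by
    rw [Matrix.trace_kronecker, Matrix.trace_kronecker, hM]; simp
  set φ := tripleProdEquiv (Fin a → Bool) (Fin b → Bool)
  obtain ⟨P', hP'⟩ := exists_qubitSMP (X := X) (Y := Y) eA eB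
    (fun x => (P.alice x).mat ⊗ₖ ((P.alice x).mat ⊗ₖ (P.alice x).mat))
    (fun x => (P.alice x).posSemidef.kronecker
      ((P.alice x).posSemidef.kronecker (P.alice x).posSemidef))
    (fun x => tr3 _ (P.alice x).trace_eq_one)
    (fun y => (P.bob y).mat ⊗ₖ ((P.bob y).mat ⊗ₖ (P.bob y).mat))
    (fun y => (P.bob y).posSemidef.kronecker
      ((P.bob y).posSemidef.kronecker (P.bob y).posSemidef))
    (fun y => tr3 _ (P.bob y).trace_eq_one)
    (fun r => (majority P.referee r).submatrix φ φ)
    (fun r => (majority_posSemidef P.referee_posSemidef r).submatrix _)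
    ((congrArg (fun M => M.submatrix φ φ) (majority_add P.referee_sum)).trans
      (Matrix.submatrix_one_equiv _))
  refine ⟨P', fun x y => ?_⟩
  set τ := (P.alice x).mat ⊗ₖ (P.bob y).mat with hτ
  have hτp : τ.PosSemidef := (P.alice x).posSemidef.kronecker (P.bob y).posSemidef
  have hτ1 : τ.trace = 1 := by
    rw [hτ, Matrix.trace_kronecker, (P.alice x).trace_eq_one, (P.bob y).trace_eq_one, one_mul]
  have hk : ((P.alice x).mat ⊗ₖ ((P.alice x).mat ⊗ₖ (P.alice x).mat)) ⊗ₖ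
      ((P.bob y).mat ⊗ₖ ((P.bob y).mat ⊗ₖ (P.bob y).mat))
      = (τ ⊗ₖ (τ ⊗ₖ τ)).submatrix φ φ := by
    ext p q
    simp only [Matrix.kroneckerMap_apply, Matrix.submatrix_apply, hτ, φ, tripleProdEquiv,
      Equiv.coe_fn_mk]
    ring
  set r := !f x y
  have hr : (P.referee r * τ).trace.re ≤ 36 / 100 := hP x y
  have h0 := trace_mul_nonneg (P.referee_posSemidef r) hτp
  have hs : (P.referee r * τ).trace + (P.referee (!r) * τ).trace = 1 := by
    have : P.referee r + P.referee (!r) = 1 := by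
      cases r
      · exact P.referee_sum
      · rw [add_comm]; exact P.referee_sum
    rw [← Matrix.trace_add, ← add_mul, this, one_mul, hτ1]
  rw [hP', hk, Matrix.submatrix_mul_equiv,
    show ∀ M : Matrix _ _ ℂ, (M.submatrix φ φ).trace = M.trace from
      fun M => Equiv.sum_comp φ fun i => M i i, trace_majority_mul, hτ1, eq_sub_of_add_eq' hs]
  obtain ⟨p, hp⟩ : ∃ p : ℝ, (P.referee r * τ).trace = p :=
    ⟨_, Complex.eq_re_of_ofReal_le (r := 0) (by simpa using h0)⟩
  rw [hp] at h0 hr ⊢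
  have h0' : 0 ≤ p := by exact_mod_cast h0
  rw [Complex.ofReal_re] at hr
  have : ((p : ℂ) ^ 2 * (1 + 2 * (1 - p))).re = p ^ 2 * (1 + 2 * (1 - p)) := by
    norm_cast
  rw [this]
  nlinarith [mul_nonneg h0' (sub_nonneg.2 hr), mul_nonneg (mul_nonneg h0' h0') (sub_nonneg.2 hr)]

/-! ### Deterministic simulation of qubit protocols -/

/-- If the output depends on Bob's input and on `k` bits computed by Alice, then Alice announces
these bits and Bob the result. -/
theorem DetProtocol.exists_of_bits {X Y : Type} (k : ℕ) (g : X → Fin k → Bool)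
    (h : (Fin k → Bool) → Y → Bool) :
    ∃ P : DetProtocol X Y, (∀ x y, P.run x y = h (g x) y) ∧ ∀ x y, P.costOn x y ≤ k + 1 := by
  induction k with
  | zero =>
    refine ⟨.bob (fun y => h Fin.elim0 y) (.output false) (.output true), fun x y => ?_,
      fun x y => ?_⟩
    · rw [Subsingleton.elim (g x) Fin.elim0]
      by_cases hb : h Fin.elim0 y = true <;> simp [DetProtocol.run, hb]
    · simp [DetProtocol.costOn]
  | succ k ih =>
    choose P hP hc using fun b : Bool =>
      ih (fun x => Fin.tail (g x)) (fun v => h (Fin.cons b v))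
    refine ⟨.alice (fun x => g x 0) (P false) (P true), fun x y => ?_, fun x y => ?_⟩
    · have hb : ∀ b, g x 0 = b → (P b).run x y = h (g x) y := by
        rintro b rfl
        rw [hP, Fin.cons_self_tail]
      cases hg : g x 0 <;> simp [DetProtocol.run, hg, hb _ hg]
    · have h0 := hc false x y
      have h1 := hc true x y
      cases hg : g x 0 <;> simp [DetProtocol.costOn, hg] <;> omega

/-- If the row of Alice's input is determined by an element of a set of size at most `2 ^ k`, then
`k + 1` bits suffice. -/
theorem detComplexity_le_of_card_le {X Y C : Type} [Fintype X] [Fintype Y] [Fintype C]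
    (f : X → Y → Bool) (k : ℕ) (hk : Fintype.card C ≤ 2 ^ k) (g : X → C)
    (hg : ∀ x x', g x = g x' → f x = f x') : detComplexity f ≤ k + 1 := by
  classical
  obtain ⟨j⟩ : Nonempty (C ↪ (Fin k → Bool)) :=
    Function.Embedding.nonempty_of_card_le (by simpa using hk)
  obtain ⟨P, hP, hc⟩ := DetProtocol.exists_of_bits k (fun x => j (g x))
    -- Bob decodes Alice's message `v` to any of her inputs which lead to it.
    (fun v y => if h : ∃ x, j (g x) = v then f h.choose y else false)
  have hf : ∀ x y, P.run x y = f x y := fun x y => by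
    have h : ∃ x', j (g x') = j (g x) := ⟨x, rfl⟩
    rw [hP, dif_pos h, hg _ _ (j.injective h.choose_spec)]
  have hD : detComplexity f ≤ P.cost := Nat.sInf_le ⟨P, hf, rfl⟩
  exact hD.trans (Finset.sup_le fun p _ => hc p.1 p.2)

/-- A positive semidefinite matrix with diagonal entries at most one has entries of modulus at most
one, since its `2 × 2` principal minors are nonnegative. -/
theorem norm_apply_le_one_of_posSemidef {n : Type*} [Fintype n] {A : Matrix n n ℂ}
    (hA : A.PosSemidef) (hd : ∀ i, (A i i).re ≤ 1) (i j : n) : ‖A i j‖ ≤ 1 := by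
  have h := (hA.submatrix ![i, j]).det_nonneg
  have hc : A j i = star (A i j) := (hA.1.apply j i).symm
  have hi := Complex.nonneg_iff.1 (hA.diag_nonneg (i := i))
  have hj := Complex.nonneg_iff.1 (hA.diag_nonneg (i := j))
  rw [Matrix.det_fin_two] at h
  simp only [Matrix.submatrix_apply, Matrix.cons_val_zero, Matrix.cons_val_one, hc] at h
  have h' := (Complex.nonneg_iff.1 h).1
  simp only [Complex.sub_re, Complex.mul_re, ← hi.2, ← hj.2, RCLike.star_def,
    Complex.conj_re, Complex.conj_im] at h'
  have hn : ‖A i j‖ ^ 2 = (A i j).re ^ 2 + (A i j).im ^ 2 := by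
    rw [← Complex.normSq_eq_norm_sq, Complex.normSq_apply]; ring
  have := hd i
  have := hd j
  nlinarith [norm_nonneg (A i j)]

theorem QubitState.norm_apply_le_one {a : ℕ} (ρ : QubitState a) (i j : Fin a → Bool) :
    ‖ρ.mat i j‖ ≤ 1 := by
  refine norm_apply_le_one_of_posSemidef ρ.posSemidef (fun i => ?_) i j
  have h := congrArg Complex.re ρ.trace_eq_one
  rw [Matrix.trace, Complex.re_sum, Complex.one_re] at h
  rw [← h]
  exact Finset.single_le_sum (f := fun i => (ρ.mat i i).re)
    (fun i _ => (Complex.nonneg_iff.1 ρ.posSemidef.diag_nonneg).1) (Finset.mem_univ i)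

namespace QubitSMP

variable {X Y : Type} {a b : ℕ}

theorem norm_referee_apply_le_one (P : QubitSMP X Y a b) (r : Bool)
    (p q : (Fin a → Bool) × (Fin b → Bool)) : ‖P.referee r p q‖ ≤ 1 := by
  refine norm_apply_le_one_of_posSemidef (P.referee_posSemidef r) (fun i => ?_) p q
  have h := congrArg (fun M => (M i i).re) P.referee_sum
  simp only [Matrix.add_apply, Complex.add_re, Matrix.one_apply_eq, Complex.one_re] at h
  have h0 := (Complex.nonneg_iff.1 ((P.referee_posSemidef false).diag_nonneg (i := i))).1
  have h1 := (Complex.nonneg_iff.1 ((P.referee_posSemidef true).diag_nonneg (i := i))).1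
  cases r <;> linarith

theorem outputProb_add (P : QubitSMP X Y a b) (x : X) (y : Y) (r : Bool) :
    P.outputProb x y r + P.outputProb x y (!r) = 1 := by
  have h : P.outputProb x y false + P.outputProb x y true = 1 := by
    rw [outputProb, outputProb, ← Complex.add_re, ← Matrix.trace_add, ← add_mul, P.referee_sum,
      one_mul, Matrix.trace_kronecker, (P.alice x).trace_eq_one, (P.bob y).trace_eq_one]
    simp
  cases r
  · exact h
  · rw [add_comm]; exact h

/-- Two states of Alice whose entries agree up to `η` lead to output probabilities which agree up
to the number of entries of the referee's matrices times `η`. -/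
theorem abs_outputProb_sub_le (P : QubitSMP X Y a b) (x x' : X) (y : Y) (r : Bool) {η : ℝ}
    (h : ∀ i j, ‖(P.alice x).mat i j - (P.alice x').mat i j‖ ≤ η) :
    |P.outputProb x y r - P.outputProb x' y r| ≤ 4 ^ (a + b) * η := by
  have hc : Fintype.card ((Fin a → Bool) × (Fin b → Bool)) = 2 ^ (a + b) := by
    simp [pow_add]
  rw [outputProb, outputProb, ← Complex.sub_re, ← Matrix.trace_sub, ← Matrix.mul_sub]
  refine (Complex.abs_re_le_norm _).trans ?_
  have hb : ∀ p q : (Fin a → Bool) × (Fin b → Bool),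
      ‖P.referee r p q * ((P.alice x).mat ⊗ₖ (P.bob y).mat
        - (P.alice x').mat ⊗ₖ (P.bob y).mat) q p‖ ≤ η := by
    intro p q
    rw [Matrix.sub_apply, Matrix.kronecker_apply, Matrix.kronecker_apply, ← sub_mul, norm_mul,
      norm_mul]
    have h1 := P.norm_referee_apply_le_one r p q
    have h2 := (P.bob y).norm_apply_le_one q.2 p.2
    have h3 := h q.1 p.1
    have h4 := mul_le_mul h3 h2 (norm_nonneg _) ((norm_nonneg _).trans h3)
    have h5 := mul_le_mul h1 h4 (by positivity) zero_le_one
    linarith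
  calc _ ≤ ∑ _p : (Fin a → Bool) × (Fin b → Bool), ∑ _q : (Fin a → Bool) × (Fin b → Bool), η := by
        rw [Matrix.trace]
        refine norm_sum_le_of_le _ fun p _ => ?_
        rw [Matrix.diag_apply, Matrix.mul_apply]
        exact norm_sum_le_of_le _ fun q _ => hb p q
    _ = _ := by
        rw [Finset.sum_const, Finset.sum_const, Finset.card_univ, hc, smul_smul, nsmul_eq_mul]
        push_cast
        rw [← mul_pow]; norm_num

/-- Since `1/3` and `2/3` differ by more than `1/4`, inputs of Alice with states that are close
enough have equal rows. -/
theorem eq_of_close (P : QubitSMP X Y a b) {f : X → Y → Bool} (hP : P.Computes f (1 / 3))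
    (x x' : X) (h : ∀ i j, ‖(P.alice x).mat i j - (P.alice x').mat i j‖ ≤ 1 / 4 ^ (a + b + 1)) :
    f x = f x' := by
  funext y
  by_contra hne
  have hne' : f x' y = !f x y := by
    revert hne; cases f x y <;> cases f x' y <;> simp
  have h1 := hP x y
  have h2 := hP x' y
  rw [hne', Bool.not_not] at h2
  have h3 := P.outputProb_add x' y (f x y)
  have h4 := (abs_le.1 (P.abs_outputProb_sub_le x x' y (!f x y) h)).1
  have h5 : (4 : ℝ) ^ (a + b) * (1 / 4 ^ (a + b + 1)) = 1 / 4 := by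
    rw [pow_succ]; field_simp
  rw [h5] at h4
  linarith

end QubitSMP

/-- The index of the cell of width `2⁻ˢ` which contains the number `t`, for `|t| ≤ 1`; there are more
indices than cells, and `Fin.ofNat` wraps around only for other `t`. -/
noncomputable def gridCell (s : ℕ) (t : ℝ) : Fin (2 ^ (s + 2)) :=
  Fin.ofNat _ ⌊2 ^ s * (t + 1)⌋₊

theorem abs_sub_le_of_gridCell_eq {s : ℕ} {t t' : ℝ} (ht : |t| ≤ 1) (ht' : |t'| ≤ 1)
    (h : gridCell s t = gridCell s t') : |t - t'| ≤ 1 / 2 ^ s := by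
  have hp : (0 : ℝ) < 2 ^ s := by positivity
  have key : ∀ u : ℝ, |u| ≤ 1 →
      0 ≤ 2 ^ s * (u + 1) ∧ ((gridCell s u : Fin _) : ℕ) = ⌊2 ^ s * (u + 1)⌋₊ := by
    intro u hu
    have hu' := abs_le.1 hu
    have h0 : 0 ≤ 2 ^ s * (u + 1) := mul_nonneg hp.le (by linarith)
    refine ⟨h0, ?_⟩
    simp only [gridCell, Fin.ofNat]
    apply Nat.mod_eq_of_lt
    rw [Nat.floor_lt h0]
    push_cast
    rw [pow_add]
    nlinarith
  obtain ⟨h0, h1⟩ := key t ht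
  obtain ⟨h0', h1'⟩ := key t' ht'
  rw [h, h1'] at h1
  have e1 := Nat.floor_le h0
  have e2 := Nat.lt_floor_add_one (2 ^ s * (t + 1))
  have e3 := Nat.floor_le h0'
  have e4 := Nat.lt_floor_add_one (2 ^ s * (t' + 1))
  rw [h1] at e3 e4
  rw [le_div_iff₀ hp, ← abs_of_pos hp, ← abs_mul, abs_le]
  constructor <;> nlinarith

/-- Alice announces the cells which contain the real and imaginary parts of the entries of her
density matrix. -/
theorem detComplexity_le_of_qubitSMP {X Y : Type} [Fintype X] [Fintype Y] {a b : ℕ}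
    (P : QubitSMP X Y a b) {f : X → Y → Bool} (hP : P.Computes f (1 / 3)) :
    detComplexity f ≤ 2 * 4 ^ a * (2 * (a + b) + 5) + 1 := by
  set s := 2 * (a + b) + 3
  refine detComplexity_le_of_card_le
    (C := (Fin a → Bool) × (Fin a → Bool) → Fin (2 ^ (s + 2)) × Fin (2 ^ (s + 2)))
    f _ (le_of_eq ?_) (fun x ij => (gridCell s ((P.alice x).mat ij.1 ij.2).re,
      gridCell s ((P.alice x).mat ij.1 ij.2).im)) fun x x' h => ?_
  · simp only [Fintype.card_fun, Fintype.card_prod, Fintype.card_fin, Fintype.card_bool]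
    rw [← pow_add, ← pow_mul]
    congr 1
    rw [← mul_pow]; simp only [s]; norm_num; ring
  · refine P.eq_of_close hP x x' fun i j => ?_
    have hij := congrFun h (i, j)
    simp only [Prod.mk.injEq] at hij
    have n1 := (P.alice x).norm_apply_le_one i j
    have n2 := (P.alice x').norm_apply_le_one i j
    have h1 := abs_sub_le_of_gridCell_eq ((Complex.abs_re_le_norm _).trans n1)
      ((Complex.abs_re_le_norm _).trans n2) hij.1
    have h2 := abs_sub_le_of_gridCell_eq ((Complex.abs_im_le_norm _).trans n1)
      ((Complex.abs_im_le_norm _).trans n2) hij.2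
    refine (Complex.norm_le_abs_re_add_abs_im _).trans ?_
    rw [Complex.sub_re, Complex.sub_im]
    have h3 : (1 : ℝ) / 2 ^ s = 1 / 4 ^ (a + b + 1) / 2 := by
      have : (2 : ℝ) ^ s = 4 ^ (a + b + 1) * 2 := by
        rw [show (4 : ℝ) = 2 ^ 2 by norm_num, ← pow_mul, ← pow_succ]
        congr 1
      rw [this]; field_simp
    linarith

/-- The logarithm of the deterministic complexity is at most of the order of the number of qubits.
-/
theorem log_detComplexity_le {X Y : Type} [Fintype X] [Fintype Y] {a b : ℕ}
    (P : QubitSMP X Y a b) {f : X → Y → Bool} (hP : P.Computes f (1 / 3)) :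
    Real.log (detComplexity f) ≤ 6 * (a + b : ℕ) := by
  rcases Nat.eq_zero_or_pos (a + b) with h0 | h0
  · -- Without qubits there is only one state, so that `f` does not depend on Alice's input and
    -- Bob's single bit suffices.
    have hs : ∀ x x', f x = f x' := fun x x' => by
      refine P.eq_of_close hP x x' fun i j => ?_
      obtain rfl : a = 0 := by omega
      have : ∀ z : X, (P.alice z).mat i j = 1 := fun z => by
        rw [Subsingleton.elim j i, ← (P.alice z).trace_eq_one, Matrix.trace,
          Fintype.sum_subsingleton _ i, Matrix.diag_apply]
      rw [this, this]; simp
    have h1 : detComplexity f ≤ 0 + 1 :=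
      detComplexity_le_of_card_le (C := Unit) f 0 (by simp) (fun _ => ()) fun x x' _ => hs x x'
    rw [h0]
    have h2 : (detComplexity f : ℝ) ≤ 1 := by exact_mod_cast h1
    simpa using Real.log_nonpos (by positivity) h2
  · have h1 : detComplexity f ≤ 64 ^ (a + b) := by
      refine (detComplexity_le_of_qubitSMP P hP).trans ?_
      have hb : ∀ q : ℕ, 0 < q → 2 * 4 ^ q * (2 * q + 5) + 1 ≤ 64 ^ q := by
        intro q hq
        induction q, hq using Nat.le_induction with
        | base => norm_num
        | succ q hq ih =>
          have := Nat.one_le_pow q 4 (by norm_num)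
          rw [pow_succ 64, pow_succ 4]
          nlinarith
      refine le_trans ?_ (hb _ h0)
      gcongr <;> omega
    rcases Nat.eq_zero_or_pos (detComplexity f) with hd | hd
    · rw [hd]; simp; positivity
    have h2 : (detComplexity f : ℝ) ≤ 64 ^ (a + b) := by exact_mod_cast h1
    refine (Real.log_le_log (by exact_mod_cast hd) h2).trans ?_
    rw [Real.log_pow, show (64 : ℝ) = 2 ^ 6 by norm_num, Real.log_pow]
    have := Real.log_two_lt_d9
    have h3 : (0 : ℝ) ≤ (a + b : ℕ) := by positivity
    push_cast at *
    nlinarith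

/-! ### Traces of products with density operators -/

section Hilbert

theorem exists_eq_star_mul_self {H : Type*} [NormedAddCommGroup H] [InnerProductSpace ℂ H]
    [CompleteSpace H] {T : H →L[ℂ] H} (hT : T.IsPositive) : ∃ B : H →L[ℂ] H, T = star B * B :=
  CStarAlgebra.nonneg_iff_eq_star_mul_self.1
    ((ContinuousLinearMap.nonneg_iff_isPositive _).2 hT)

variable {ι κ : Type}

theorem inner_ket_left [DecidableEq ι] (i : ι) (v : ℓ²(ι, ℂ)) : inner ℂ (ket i) v = v i := by
  rw [ket, lp.inner_single_left]; simp

theorem inner_ket_right [DecidableEq ι] (i : ι) (v : ℓ²(ι, ℂ)) :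
    inner ℂ v (ket i) = star (v i) := by
  rw [← inner_conj_symm, inner_ket_left, starRingEnd_apply]

theorem tensorVec_apply (v : ℓ²(ι, ℂ)) (w : ℓ²(κ, ℂ)) (p : ι × κ) :
    tensorVec v w p = v p.1 * w p.2 := rfl

theorem hasSum_norm_sq (v : ℓ²(ι, ℂ)) : HasSum (fun i => ‖v i‖ ^ 2) (‖v‖ ^ 2) := by
  have h := (Complex.hasSum_iff _ _).1 (lp.hasSum_inner v v)
  have h1 : ∀ i, (inner ℂ (v i) (v i)).re = ‖v i‖ ^ 2 := fun i => by
    rw [← inner_self_eq_norm_sq (𝕜 := ℂ)]; rfl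
  have h2 : (inner ℂ v v).re = ‖v‖ ^ 2 := by
    rw [← inner_self_eq_norm_sq (𝕜 := ℂ)]; rfl
  simpa only [h1, h2] using h.1

/-- A double series of nonnegative terms may be summed by rows. -/
theorem hasSum_prod_of_nonneg {α β : Type*} {f : α × β → ℝ} (hf : ∀ p, 0 ≤ f p) {g : α → ℝ} {s : ℝ}
    (h : ∀ a, HasSum (fun b => f (a, b)) (g a)) (hg : HasSum g s) : HasSum f s := by
  have hs : Summable f := (summable_prod_of_nonneg hf).2
    ⟨fun a => (h a).summable, hg.summable.congr fun a => (h a).tsum_eq.symm⟩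
  exact (hs.hasSum.prod_fiberwise h).unique hg ▸ hs.hasSum

/-- A double series of nonnegative terms may be summed by rows or by columns. -/
theorem hasSum_swap_of_nonneg {α β : Type*} {f : α → β → ℝ} (hf : ∀ a b, 0 ≤ f a b) {g : α → ℝ}
    {g' : β → ℝ} {s : ℝ} (h : ∀ a, HasSum (fun b => f a b) (g a)) (hg : HasSum g s)
    (h' : ∀ b, HasSum (fun a => f a b) (g' b)) : HasSum g' s :=
  ((Equiv.prodComm β α).hasSum_iff.2 (hasSum_prod_of_nonneg (f := fun p => f p.1 p.2)
    (fun p => hf p.1 p.2) h hg)).prod_fiberwise h'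

theorem norm_tensorVec_sq (v : ℓ²(ι, ℂ)) (w : ℓ²(κ, ℂ)) :
    ‖tensorVec v w‖ ^ 2 = ‖v‖ ^ 2 * ‖w‖ ^ 2 := by
  refine (hasSum_norm_sq (tensorVec v w)).unique (hasSum_prod_of_nonneg (fun _ => by positivity)
    (fun i => ?_) ((hasSum_norm_sq v).mul_right _))
  simpa only [tensorVec_apply, norm_mul, mul_pow] using (hasSum_norm_sq w).mul_left (‖v i‖ ^ 2)

theorem norm_apply_le (v : ℓ²(ι, ℂ)) (i : ι) : ‖v i‖ ≤ ‖v‖ :=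
  lp.norm_apply_le_norm (by norm_num) v i

/-- A density operator is a sum of rank-one operators `|a i⟩⟨a i|` whose squared norms add up
to one. -/
theorem DensityOperator.exists_decomposition [DecidableEq ι] (ρ : DensityOperator ι) :
    ∃ a : ι → ℓ²(ι, ℂ), HasSum (fun i => ‖a i‖ ^ 2) 1 ∧
      ∀ k l, HasSum (fun i => a i k * star (a i l)) (ρ.op (ket l) k) := by
  obtain ⟨B, hB⟩ := exists_eq_star_mul_self ρ.isPositive
  have hB' : ∀ v w, inner ℂ v (ρ.op w) = inner ℂ (B v) (B w) := fun v w => by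
    rw [hB, ContinuousLinearMap.star_eq_adjoint]
    exact ContinuousLinearMap.adjoint_inner_right B v (B w)
  have ha : ∀ i k, (star B) (ket i) k = star (B (ket k) i) := fun i k => by
    rw [← inner_ket_left, ContinuousLinearMap.star_eq_adjoint,
      ContinuousLinearMap.adjoint_inner_right, inner_ket_right]
  have hd : ∀ k l, HasSum (fun i => (star B) (ket i) k * star ((star B) (ket i) l))
      (ρ.op (ket l) k) := fun k l => by
    rw [← inner_ket_left, hB']
    refine (lp.hasSum_inner (B (ket k)) (B (ket l))).congr_fun fun i => ?_
    rw [ha, ha, star_star, RCLike.inner_apply, mul_comm]; rfl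
  refine ⟨fun i => star B (ket i), ?_, hd⟩
  have hr := ((Complex.hasSum_iff _ _).1 ρ.hasSum_trace).1
  refine hasSum_swap_of_nonneg (f := fun k i => ‖(star B) (ket i) k‖ ^ 2) (fun _ _ => by positivity)
    (fun k => ?_) hr (fun i => hasSum_norm_sq _)
  rw [inner_ket_left]
  refine ((Complex.hasSum_iff _ _).1 (hd k k)).1.congr_fun fun i => ?_
  rw [RCLike.star_def, Complex.mul_conj, Complex.ofReal_re, Complex.normSq_eq_norm_sq]

theorem hasSum_mul_prod {f : ι → ℂ} {g : κ → ℂ} {s t : ℂ} (hf : HasSum f s) (hg : HasSum g t) :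
    HasSum (fun q : ι × κ => f q.1 * g q.2) (s * t) :=
  hf.mul hg (summable_mul_of_summable_norm hf.summable.norm hg.summable.norm)

/-- The product of two density operators is a sum of rank-one operators `|w q⟩⟨w q|` whose squared
norms add up to one. -/
theorem exists_decomposition_tensor [DecidableEq ι] [DecidableEq κ] (ρ : DensityOperator ι)
    (σ : DensityOperator κ) :
    ∃ w : ι × κ → ℓ²(ι × κ, ℂ), HasSum (fun q => ‖w q‖ ^ 2) 1 ∧
      ∀ p p', HasSum (fun q => w q p * star (w q p'))
        (ρ.op (ket p'.1) p.1 * σ.op (ket p'.2) p.2) := by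
  obtain ⟨a, ha, ha'⟩ := ρ.exists_decomposition
  obtain ⟨b, hb, hb'⟩ := σ.exists_decomposition
  refine ⟨fun q => tensorVec (a q.1) (b q.2), ?_, fun p p' => ?_⟩
  · have hb1 : ∀ i, HasSum (fun j => ‖a i‖ ^ 2 * ‖b j‖ ^ 2) (‖a i‖ ^ 2) := fun i => by
      simpa only [mul_one] using hb.mul_left (‖a i‖ ^ 2)
    have h := hasSum_prod_of_nonneg (f := fun q : ι × κ => ‖a q.1‖ ^ 2 * ‖b q.2‖ ^ 2)
      (fun q => mul_nonneg (sq_nonneg _) (sq_nonneg _)) hb1 ha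
    exact h.congr_fun fun q => norm_tensorVec_sq _ _
  · have h := hasSum_mul_prod (f := fun i => a i p.1 * star (a i p'.1))
      (g := fun j => b j p.2 * star (b j p'.2)) (ha' p.1 p'.1) (hb' p.2 p'.2)
    refine h.congr_fun fun q => ?_
    rw [tensorVec_apply, tensorVec_apply, star_mul']
    exact mul_mul_mul_comm _ _ _ _

/-- The trace of `E τ` for `τ = ∑ |w q⟩⟨w q|`. -/
theorem hasSum_inner_trace [DecidableEq ι] {w : ι → ℓ²(ι, ℂ)} (hw : Summable fun q => ‖w q‖ ^ 2)
    {τ : ι → ℓ²(ι, ℂ)} (hτ : ∀ p p', HasSum (fun q => w q p * star (w q p')) (τ p' p))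
    (E : ℓ²(ι, ℂ) →L[ℂ] ℓ²(ι, ℂ)) :
    HasSum (fun q => inner ℂ (w q) (E (w q))) (∑' p, inner ℂ (ket p) (E (τ p))) := by
  -- The series for `τ p` converges in norm.
  have hτs : ∀ p, HasSum (fun q => star (w q p) • w q) (τ p) := fun p => by
    have hs : Summable fun q => star (w q p) • w q := by
      refine Summable.of_norm_bounded hw fun q => ?_
      rw [norm_smul, norm_star, sq]
      exact mul_le_mul_of_nonneg_right (norm_apply_le _ _) (norm_nonneg _)
    obtain ⟨v, hv⟩ := hs
    have : v = τ p := by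
      ext p'
      have h := hv.mapL (innerSL ℂ (ket p'))
      simp only [innerSL_apply_apply, inner_ket_left] at h
      refine h.unique ((hτ p' p).congr_fun fun q => ?_)
      rw [lp.coeFn_smul, Pi.smul_apply, smul_eq_mul, mul_comm]
    exact this ▸ hv
  have hrow : ∀ p, HasSum (fun q => star (w q p) * E (w q) p) (inner ℂ (ket p) (E (τ p))) :=
    fun p => by
      have h := ((hτs p).mapL E).mapL (innerSL ℂ (ket p))
      simp only [innerSL_apply_apply, inner_ket_left, map_smul] at h
      rw [inner_ket_left]
      exact h.congr_fun fun q => rfl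
  have hcol : ∀ q, HasSum (fun p => star (w q p) * E (w q) p) (inner ℂ (w q) (E (w q))) :=
    fun q => (lp.hasSum_inner (w q) (E (w q))).congr_fun fun p => by
      rw [RCLike.inner_apply, mul_comm]; rfl
  have hb : ∀ q p, ‖star (w q p) * E (w q) p‖ ≤ ‖w q p‖ ^ 2 + ‖E (w q) p‖ ^ 2 := fun q p => by
    rw [norm_mul, norm_star]
    nlinarith [sq_nonneg (‖w q p‖ - ‖E (w q) p‖), norm_nonneg (w q p), norm_nonneg (E (w q) p)]
  have hS : Summable fun z : ι × ι => star (w z.1 z.2) * E (w z.1) z.2 := by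
    refine Summable.of_norm_bounded
      (g := fun z : ι × ι => ‖w z.1 z.2‖ ^ 2 + ‖E (w z.1) z.2‖ ^ 2) ?_ fun z => hb z.1 z.2
    have hsq : Summable fun q => ‖w q‖ ^ 2 + ‖E (w q)‖ ^ 2 := by
      refine hw.add (Summable.of_nonneg_of_le (fun _ => by positivity) (fun q => ?_)
        (hw.mul_left (‖E‖ ^ 2)))
      rw [← mul_pow]
      exact pow_le_pow_left₀ (norm_nonneg _) (E.le_opNorm _) 2
    exact (hasSum_prod_of_nonneg
      (f := fun z : ι × ι => ‖w z.1 z.2‖ ^ 2 + ‖E (w z.1) z.2‖ ^ 2) (fun _ => by positivity)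
      (fun q => (hasSum_norm_sq (w q)).add (hasSum_norm_sq (E (w q)))) hsq.hasSum).summable
  have h1 := hS.hasSum.prod_fiberwise hcol
  have h2 := ((Equiv.prodComm ι ι).hasSum_iff.2 hS.hasSum).prod_fiberwise hrow
  rw [h2.tsum_eq]
  exact h1

/-- The effect of a perturbation of a vector on a quadratic form with `0 ≤ E ≤ 1`. -/
theorem re_inner_le_of_isPositive {H : Type*} [NormedAddCommGroup H] [InnerProductSpace ℂ H]
    [CompleteSpace H]
    {E E' : H →L[ℂ] H} (hE : E.IsPositive) (hE' : E'.IsPositive) (h : E + E' = 1) (u w : H)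
    {t : ℝ} (ht : 0 < t) :
    (inner ℂ u (E u)).re ≤ (1 + t) * (inner ℂ w (E w)).re + (1 + 1 / t) * ‖u - w‖ ^ 2 := by
  obtain ⟨B, hB⟩ := exists_eq_star_mul_self hE
  have hB' : ∀ v, (inner ℂ v (E v)).re = ‖B v‖ ^ 2 := fun v => by
    rw [hB, ContinuousLinearMap.star_eq_adjoint, ← inner_self_eq_norm_sq (𝕜 := ℂ)]
    exact congrArg Complex.re (ContinuousLinearMap.adjoint_inner_right B v (B v))
  have hd : ‖B (u - w)‖ ^ 2 ≤ ‖u - w‖ ^ 2 := by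
    rw [← hB', ← inner_self_eq_norm_sq (𝕜 := ℂ)]
    have h1 := (Complex.nonneg_iff.1 (hE'.inner_nonneg_right (u - w))).1
    have h2 : (inner ℂ (u - w) (E (u - w))).re + (inner ℂ (u - w) (E' (u - w))).re
        = (inner ℂ (u - w) (u - w)).re := by
      rw [← Complex.add_re, ← inner_add_right]
      exact congrArg (fun T : H →L[ℂ] H => (inner ℂ (u - w) (T (u - w))).re) h
    exact (le_add_of_nonneg_right h1).trans_eq h2
  rw [hB', hB']
  have hn : ‖B u‖ ≤ ‖B w‖ + ‖B (u - w)‖ := by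
    have : B u = B w + B (u - w) := by rw [← map_add]; congr 1; abel
    rw [this]; exact norm_add_le _ _
  have hq : (‖B w‖ + ‖B (u - w)‖) ^ 2 ≤
      (1 + t) * ‖B w‖ ^ 2 + (1 + 1 / t) * ‖B (u - w)‖ ^ 2 := by
    have : (1 + t) * ‖B w‖ ^ 2 + (1 + 1 / t) * ‖B (u - w)‖ ^ 2 - (‖B w‖ + ‖B (u - w)‖) ^ 2
        = (t * ‖B w‖ - ‖B (u - w)‖) ^ 2 / t := by
      field_simp; ring
    have h0 : 0 ≤ (t * ‖B w‖ - ‖B (u - w)‖) ^ 2 / t := by positivity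
    linarith
  have h3 : (1 + 1 / t) * ‖B (u - w)‖ ^ 2 ≤ (1 + 1 / t) * ‖u - w‖ ^ 2 :=
    mul_le_mul_of_nonneg_left hd (by positivity)
  have h4 := pow_le_pow_left₀ (norm_nonneg _) hn 2
  linarith

/-! ### Truncation to finitely many basis vectors -/

/-- The projection of `v` to the span of the basis vectors with index in `T`. -/
noncomputable def truncate [DecidableEq ι] (T : Finset ι) (v : ℓ²(ι, ℂ)) : ℓ²(ι, ℂ) := ∑ p ∈ T, v p • ket p

theorem ket_apply [DecidableEq ι] (i j : ι) : (ket i : ℓ²(ι, ℂ)) j = if i = j then 1 else 0 := by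
  rw [ket, lp.single_apply, Pi.single_apply]
  simp only [eq_comm]

theorem truncate_apply [DecidableEq ι] (T : Finset ι) (v : ℓ²(ι, ℂ)) (i : ι) :
    truncate T v i = if i ∈ T then v i else 0 := by
  rw [truncate, lp.coeFn_sum, Finset.sum_apply]
  simp [ket_apply, Finset.sum_ite_eq']

theorem norm_truncate_sub_sq [DecidableEq ι] (T : Finset ι) (v : ℓ²(ι, ℂ)) :
    ‖truncate T v - v‖ ^ 2 = ‖v‖ ^ 2 - ∑ p ∈ T, ‖v p‖ ^ 2 := by
  have h1 : HasSum (fun p => if p ∈ T then ‖v p‖ ^ 2 else 0) (∑ p ∈ T, ‖v p‖ ^ 2) := by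
    have : HasSum (fun p => if p ∈ T then ‖v p‖ ^ 2 else 0) _ :=
      hasSum_sum_of_ne_finset_zero (s := T) (fun p hp => if_neg hp)
    rwa [Finset.sum_congr rfl fun p hp => if_pos hp] at this
  refine (hasSum_norm_sq _).unique (((hasSum_norm_sq v).sub h1).congr_fun fun p => ?_)
  rw [lp.coeFn_sub, Pi.sub_apply, truncate_apply]
  split_ifs <;> simp

theorem inner_truncate [DecidableEq ι] (T : Finset ι) (E : ℓ²(ι, ℂ) →L[ℂ] ℓ²(ι, ℂ))
    (v : ℓ²(ι, ℂ)) : inner ℂ (truncate T v) (E (truncate T v)) =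
      ∑ p ∈ T, ∑ p' ∈ T, E (ket p') p * (v p' * star (v p)) := by
  simp only [truncate, map_sum, map_smul, sum_inner, inner_sum, inner_smul_left, inner_smul_right,
    inner_ket_left, Finset.mul_sum]
  rw [Finset.sum_comm]
  refine Finset.sum_congr rfl fun p _ => Finset.sum_congr rfl fun p' _ => ?_
  rw [RCLike.star_def]; ring

/-- The compression of an operator on `ℓ²(ι)` to the basis vectors with index in the range
of `e`, as a matrix. -/
noncomputable def compress [DecidableEq ι] {n : Type} (e : n → ι) (E : ℓ²(ι, ℂ) →L[ℂ] ℓ²(ι, ℂ)) :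
    Matrix n n ℂ :=
  Matrix.of fun i j => E (ket (e j)) (e i)

theorem compress_posSemidef [DecidableEq ι] {n : Type} [Fintype n] (e : n → ι)
    {E : ℓ²(ι, ℂ) →L[ℂ] ℓ²(ι, ℂ)} (hE : E.IsPositive) : (compress e E).PosSemidef := by
  obtain ⟨B, hB⟩ := exists_eq_star_mul_self hE
  have : compress e E = Matrix.gram ℂ (fun i => B (ket (e i))) := by
    ext i j
    rw [Matrix.gram_apply, compress, Matrix.of_apply, ← inner_ket_left, hB,
      ContinuousLinearMap.star_eq_adjoint]
    exact ContinuousLinearMap.adjoint_inner_right B _ _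
  rw [this]
  exact Matrix.posSemidef_gram ℂ _

theorem compress_add_eq_one [DecidableEq ι] {n : Type} [DecidableEq n] {e : n → ι}
    (he : Function.Injective e) {E E' : ℓ²(ι, ℂ) →L[ℂ] ℓ²(ι, ℂ)} (h : E + E' = 1) :
    compress e E + compress e E' = 1 := by
  ext i j
  have := congrArg (fun T : ℓ²(ι, ℂ) →L[ℂ] ℓ²(ι, ℂ) => T (ket (e j)) (e i)) h
  refine this.trans ?_
  rw [Matrix.one_apply]
  refine (ket_apply _ _).trans ?_
  simp only [he.eq_iff, eq_comm]

/-- Truncating both states to finitely many basis vectors, whose weights are at least `1 - δ`,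
changes the probability of an outcome only slightly. -/
theorem trace_compress_le [DecidableEq ι] [DecidableEq κ] {ρ : DensityOperator ι}
    {σ : DensityOperator κ} {E E' : ℓ²(ι × κ, ℂ) →L[ℂ] ℓ²(ι × κ, ℂ)} (hE : E.IsPositive)
    (hE' : E'.IsPositive) (h : E + E' = 1) (T : Finset ι) (U : Finset κ) {t : ℝ} (ht : 0 < t) :
    (compress (Prod.map Subtype.val Subtype.val : T × U → ι × κ) E *
      (compress (Subtype.val : T → ι) ρ.op ⊗ₖ compress (Subtype.val : U → κ) σ.op)).trace.re ≤
    (1 + t) * (traceTensor E ρ σ).re + (1 + 1 / t) *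
      (1 - ((compress (Subtype.val : T → ι) ρ.op).trace *
        (compress (Subtype.val : U → κ) σ.op).trace).re) := by
  obtain ⟨w, hw, hτ⟩ := exists_decomposition_tensor ρ σ
  have h1 : HasSum (fun q => (inner ℂ (w q) (E (w q))).re) (traceTensor E ρ σ).re :=
    ((Complex.hasSum_iff _ _).1 (hasSum_inner_trace hw.summable
      (τ := fun p => tensorVec (ρ.op (ket p.1)) (σ.op (ket p.2))) hτ E)).1
  have h2 : HasSum (fun q => (inner ℂ (truncate (T ×ˢ U) (w q)) (E (truncate (T ×ˢ U) (w q)))).re)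
      (compress (Prod.map Subtype.val Subtype.val : T × U → ι × κ) E *
        (compress (Subtype.val : T → ι) ρ.op ⊗ₖ compress (Subtype.val : U → κ) σ.op)).trace.re := by
    have hs := hasSum_sum (s := T ×ˢ U) fun p _ => hasSum_sum (s := T ×ˢ U) fun p' _ =>
      (hτ p' p).mul_left (E (ket p') p)
    simp only [← inner_truncate] at hs
    have he : (compress (Prod.map Subtype.val Subtype.val : T × U → ι × κ) E *
        (compress (Subtype.val : T → ι) ρ.op ⊗ₖ compress (Subtype.val : U → κ) σ.op)).trace =
        ∑ p ∈ T ×ˢ U, ∑ p' ∈ T ×ˢ U,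
          E (ket p') p * (ρ.op (ket p.1) p'.1 * σ.op (ket p.2) p'.2) := by
      simp only [Matrix.trace, Matrix.diag_apply, Matrix.mul_apply, Fintype.sum_prod_type,
        Finset.sum_product, Finset.univ_eq_attach]
      rw [← Finset.sum_attach T]
      refine Finset.sum_congr rfl fun i _ => ?_
      rw [← Finset.sum_attach U]
      refine Finset.sum_congr rfl fun j _ => ?_
      rw [← Finset.sum_attach T]
      refine Finset.sum_congr rfl fun i' _ => ?_
      rw [← Finset.sum_attach U]
      rfl
    rw [he]
    exact ((Complex.hasSum_iff _ _).1 hs).1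
  have h3 : HasSum (fun q => ‖truncate (T ×ˢ U) (w q) - w q‖ ^ 2)
      (1 - ((compress (Subtype.val : T → ι) ρ.op).trace *
        (compress (Subtype.val : U → κ) σ.op).trace).re) := by
    simp only [norm_truncate_sub_sq]
    refine hw.sub ?_
    have hs := hasSum_sum (s := T ×ˢ U) fun p _ => hτ p p
    have he : (compress (Subtype.val : T → ι) ρ.op).trace *
        (compress (Subtype.val : U → κ) σ.op).trace =
        ∑ p ∈ T ×ˢ U, ρ.op (ket p.1) p.1 * σ.op (ket p.2) p.2 := by
      rw [Finset.sum_product' T U fun i j => ρ.op (ket i) i * σ.op (ket j) j,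
        ← Finset.sum_mul_sum, ← Finset.sum_attach T, ← Finset.sum_attach U]
      rfl
    rw [he]
    refine ((Complex.hasSum_iff _ _).1 hs).1.congr_fun fun q => ?_
    rw [Complex.re_sum]
    refine Finset.sum_congr rfl fun p _ => ?_
    rw [RCLike.star_def, Complex.mul_conj, Complex.ofReal_re, Complex.normSq_eq_norm_sq]
  exact hasSum_le (fun q => re_inner_le_of_isPositive hE hE' h (truncate (T ×ˢ U) (w q)) (w q) ht)
    h2 ((h1.mul_left _).add (h3.mul_left _))

end Hilbert

/-! ### Weight of the states with few photons -/

/-- The weight of the basis vectors with at most `K` photons, by Markov's inequality. -/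
theorem le_trace_compress {m : ℕ} (ρ : DensityOperator (FockIndex m))
    (hρ : meanPhotonNumber ρ ≠ ⊤) (K : ℕ) (T : Finset (FockIndex m))
    (hT : ∀ k : FockIndex m, ∑ i, k i ≤ K → k ∈ T) :
    1 - (meanPhotonNumber ρ).toReal / (K + 1) ≤
      (compress (Subtype.val : T → FockIndex m) ρ.op).trace.re := by
  set p : FockIndex m → ℝ := fun k => (inner ℂ (ket k) (ρ.op (ket k))).re with hp
  have hp0 : ∀ k, 0 ≤ p k := fun k =>
    (Complex.nonneg_iff.1 (ρ.isPositive.inner_nonneg_right _)).1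
  have hp1 : HasSum p 1 := ((Complex.hasSum_iff _ _).1 ρ.hasSum_trace).1
  have hN : HasSum (fun k : FockIndex m => ((∑ i, k i : ℕ) : ℝ) * p k)
      (meanPhotonNumber ρ).toReal := by
    have h := (ENNReal.summable_toReal hρ).hasSum
    rw [← ENNReal.tsum_toReal_eq fun k => ENNReal.ne_top_of_tsum_ne_top hρ k] at h
    refine h.congr_fun fun k => ?_
    rw [ENNReal.toReal_mul, ENNReal.toReal_natCast, ENNReal.toReal_ofReal (hp0 k)]
  have hTs : HasSum (fun k => if k ∈ T then p k else 0) (∑ k ∈ T, p k) := by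
    have : HasSum (fun k => if k ∈ T then p k else 0) _ :=
      hasSum_sum_of_ne_finset_zero (s := T) (fun k hk => if_neg hk)
    rwa [Finset.sum_congr rfl fun k hk => if_pos hk] at this
  have hK : (0 : ℝ) < K + 1 := by positivity
  have hle := hasSum_le (fun k => ?_) hp1 (hTs.add (hN.div_const ((K : ℝ) + 1)))
  · have ht : (compress (Subtype.val : T → FockIndex m) ρ.op).trace.re = ∑ k ∈ T, p k := by
      rw [Matrix.trace, Complex.re_sum, ← Finset.sum_attach T]
      refine Finset.sum_congr rfl fun k _ => ?_
      rw [hp]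
      simp only []
      rw [inner_ket_left]; rfl
    rw [ht]; linarith
  · split_ifs with hk
    · have := hp0 k
      have : 0 ≤ ((∑ i, k i : ℕ) : ℝ) * p k / (K + 1) := by positivity
      linarith
    · have h1 : K + 1 ≤ ∑ i, k i := by
        by_contra hlt
        exact hk (hT k (by omega))
      have h2 : (K : ℝ) + 1 ≤ ((∑ i, k i : ℕ) : ℝ) := by exact_mod_cast h1
      rw [zero_add, le_div_iff₀ hK, mul_comm]
      exact mul_le_mul_of_nonneg_right h2 (hp0 k)

/-! ### Dimension of the space of states with few photons -/

/-- The labels of the basis vectors with at most `K` photons in `m` modes. -/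
def boundedFock (m K : ℕ) : Finset (FockIndex m) :=
  (Fintype.piFinset fun _ => Finset.range (K + 1)).filter fun k => ∑ i, k i ≤ K

theorem mem_boundedFock {m K : ℕ} {k : FockIndex m} : k ∈ boundedFock m K ↔ ∑ i, k i ≤ K := by
  rw [boundedFock, Finset.mem_filter, and_iff_right_iff_imp, Fintype.mem_piFinset]
  intro h i
  rw [Finset.mem_range, Nat.lt_succ_iff]
  exact (Finset.single_le_sum (fun i _ => Nat.zero_le (k i)) (Finset.mem_univ i)).trans h

theorem card_boundedFock_le_pow_modes (m K : ℕ) : (boundedFock m K).card ≤ (K + 1) ^ m := by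
  refine (Finset.card_filter_le _ _).trans_eq ?_
  simp

theorem card_boundedFock_le_pow_photons (m K : ℕ) : (boundedFock m K).card ≤ (m + 1) ^ K := by
  induction K with
  | zero =>
    refine (card_boundedFock_le_pow_modes m 0).trans_eq ?_
    simp
  | succ K ih =>
    -- A label with at most `K + 1` photons arises from one with at most `K` photons by adding
    -- a photon in one of the modes, or no photon.
    have hs : boundedFock m (K + 1) ⊆
        (boundedFock m K ×ˢ (Finset.univ : Finset (Option (Fin m)))).image
          fun q => q.1 + q.2.elim 0 fun i => Pi.single i 1 := by
      intro k hk
      rw [mem_boundedFock] at hk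
      rw [Finset.mem_image]
      by_cases h : ∑ i, k i ≤ K
      · exact ⟨(k, none), by simp [mem_boundedFock, h], by simp⟩
      · obtain ⟨i, hi⟩ : ∃ i, k i ≠ 0 := by
          by_contra! h0
          exact h (by simp [h0])
        have hle : Pi.single i 1 ≤ k := by
          intro j
          rcases eq_or_ne j i with rfl | hj
          · rw [Pi.single_eq_same]; exact Nat.one_le_iff_ne_zero.2 hi
          · rw [Pi.single_eq_of_ne hj]; exact Nat.zero_le _
        have hk' : k - Pi.single i 1 + Pi.single i 1 = k := tsub_add_cancel_of_le hle
        refine ⟨(k - Pi.single i 1, some i), ?_, hk'⟩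
        have hsum := congrArg (fun k : FockIndex m => ∑ i, k i) hk'
        simp only [Pi.add_apply, Finset.sum_add_distrib, Finset.sum_pi_single', Finset.mem_univ,
          if_true] at hsum
        simp only [Finset.mem_product, mem_boundedFock, Finset.mem_univ, and_true]
        have hone : ∑ j, (Pi.single i 1 : FockIndex m) j = 1 := by simp
        omega
    refine (Finset.card_le_card hs).trans (Finset.card_image_le.trans ?_)
    rw [Finset.card_product, Finset.card_univ, Fintype.card_option, Fintype.card_fin, pow_succ]
    exact Nat.mul_le_mul_right _ ih

theorem log_add_one_le {n : ℕ} (hn : 2 ≤ n) : ((Nat.log 2 n + 1 : ℕ) : ℝ) ≤ 3 * Real.log n := by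
  have h0 : (2 : ℝ) ≤ n := by exact_mod_cast hn
  have h1 : Real.log 2 ≤ Real.log n := Real.log_le_log (by norm_num) h0
  have h2 : (Nat.log 2 n : ℝ) * Real.log 2 ≤ Real.log n := by
    rw [← Real.log_pow]
    refine Real.log_le_log (by positivity) ?_
    exact_mod_cast Nat.pow_log_le_self 2 (by omega)
  have := Real.log_two_gt_d9
  push_cast
  nlinarith [Nat.cast_nonneg (α := ℝ) (Nat.log 2 n)]

/-- The number of qubits which hold the states with at most `10⁴ μ` photons. -/
theorem clog_card_boundedFock_le {m : ℕ} (hm : 2 ≤ m) {μ : ℝ} (hμ : 0 ≤ μ) :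
    (Nat.clog 2 (boundedFock m ⌊μ * 10 ^ 4⌋₊).card : ℝ) ≤
      3 * 10 ^ 4 * opticalCost (1 / 10 ^ 4) μ m := by
  set K := ⌊μ * 10 ^ 4⌋₊ with hK
  have hKμ : (K : ℝ) ≤ μ * 10 ^ 4 := Nat.floor_le (by positivity)
  have hlog : ∀ n : ℕ, n + 1 ≤ 2 ^ (Nat.log 2 n + 1) := fun n =>
    Nat.lt_pow_succ_log_self (by norm_num) n
  have hm1 : 0 ≤ Real.log m := Real.log_natCast_nonneg m
  rw [opticalCost, mul_min_of_nonneg _ _ (by norm_num)]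
  refine le_min ?_ ?_
  · have h : Nat.clog 2 (boundedFock m K).card ≤ (Nat.log 2 m + 1) * K := by
      refine Nat.clog_le_of_le_pow ((card_boundedFock_le_pow_photons m K).trans ?_)
      rw [pow_mul]
      exact Nat.pow_le_pow_left (hlog m) K
    calc (Nat.clog 2 (boundedFock m K).card : ℝ) ≤ ((Nat.log 2 m + 1 : ℕ) : ℝ) * K := by
          exact_mod_cast h
      _ ≤ (3 * Real.log m) * (μ * 10 ^ 4) := by
          gcongr
          exact log_add_one_le hm
      _ = _ := by ring
  · rw [show 1 + μ / (1 / 10 ^ 4) = 1 + μ * 10 ^ 4 by simp]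
    have hl0 : 0 ≤ Real.log (1 + μ * 10 ^ 4) := Real.log_nonneg (by linarith)
    -- For `K = 0` only the vacuum is left, which takes no qubits.
    rcases Nat.eq_zero_or_pos K with h0 | h0
    · have h : Nat.clog 2 (boundedFock m K).card ≤ 0 := by
        refine Nat.clog_le_of_le_pow ((card_boundedFock_le_pow_modes m K).trans_eq ?_)
        simp [h0]
      rw [Nat.le_zero.1 h]
      simp only [Nat.cast_zero]
      positivity
    · have h : Nat.clog 2 (boundedFock m K).card ≤ (Nat.log 2 (K + 1) + 1) * m := by
        refine Nat.clog_le_of_le_pow ((card_boundedFock_le_pow_modes m K).trans ?_)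
        rw [pow_mul]
        exact Nat.pow_le_pow_left ((Nat.le_succ _).trans (hlog (K + 1))) m
      have h1 : Real.log ((K + 1 : ℕ) : ℝ) ≤ Real.log (1 + μ * 10 ^ 4) := by
        refine Real.log_le_log (by positivity) ?_
        push_cast; linarith
      calc (Nat.clog 2 (boundedFock m K).card : ℝ) ≤ ((Nat.log 2 (K + 1) + 1 : ℕ) : ℝ) * m := by
            exact_mod_cast h
        _ ≤ (3 * Real.log (1 + μ * 10 ^ 4)) * m := by
            gcongr
            exact (log_add_one_le (by omega)).trans (by gcongr)
        _ ≤ _ := by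
            have : 0 ≤ (m : ℝ) * Real.log (1 + μ * 10 ^ 4) := by positivity
            linarith

/-! ### From optical protocols to qubit protocols -/

/-- A density matrix on the span of finitely many basis vectors, obtained from a density operator which
has nonzero weight there by compression and normalization. -/
theorem exists_normalized_compress {ι : Type} [DecidableEq ι] (ρ : DensityOperator ι) (T : Finset ι)
    (h : 0 < (compress (Subtype.val : T → ι) ρ.op).trace.re) :
    ∃ (s : ℝ), (compress (Subtype.val : T → ι) ρ.op).trace = s ∧ 0 < s ∧
      (((s⁻¹ : ℝ) : ℂ) • compress (Subtype.val : T → ι) ρ.op).PosSemidef ∧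
      (((s⁻¹ : ℝ) : ℂ) • compress (Subtype.val : T → ι) ρ.op).trace = 1 := by
  have hp := compress_posSemidef (Subtype.val : T → ι) ρ.isPositive
  obtain ⟨s, hs⟩ : ∃ s : ℝ, (compress (Subtype.val : T → ι) ρ.op).trace = s :=
    ⟨_, Complex.eq_re_of_ofReal_le (r := 0) (by simpa using hp.trace_nonneg)⟩
  rw [hs, Complex.ofReal_re] at h
  refine ⟨s, hs, h, hp.smul ?_, ?_⟩
  · exact_mod_cast (inv_pos.2 h).le
  · rw [Matrix.trace_smul, hs, smul_eq_mul, ← Complex.ofReal_mul, inv_mul_cancel₀ h.ne',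
      Complex.ofReal_one]

/-- Truncation to `10⁴ μ` photons turns an optical protocol into a qubit protocol whose error is
only slightly larger. -/
theorem exists_qubitSMP_of_opticalSMP {X Y : Type} {m : ℕ} (hm : 2 ≤ m) (P : OpticalSMP X Y m)
    {f : X → Y → Bool} (hP : P.Computes f (1 / 3)) (hμ : P.maxMeanPhotonNumber ≠ ⊤) {a : ℕ}
    (ha : (boundedFock m ⌊P.maxMeanPhotonNumber.toReal * 10 ^ 4⌋₊).card ≤ 2 ^ a) :
    ∃ P' : QubitSMP X Y a a, P'.Computes f (36 / 100) := by
  set K := ⌊P.maxMeanPhotonNumber.toReal * 10 ^ 4⌋₊ with hK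
  have : NeZero m := ⟨by omega⟩
  -- Enlarging the set of basis vectors to a power of two makes the truncated space a space of
  -- qubits, so that no measurement outside of it has to be specified.
  obtain ⟨T, hT, hTc⟩ := Infinite.exists_superset_card_eq (boundedFock m K) (2 ^ a) ha
  let e : (Fin a → Bool) ≃ T := Fintype.equivOfCardEq (by simp [hTc])
  have hw : ∀ ρ : DensityOperator (FockIndex m), meanPhotonNumber ρ ≤ P.maxMeanPhotonNumber →
      1 - 1 / 10 ^ 4 ≤ (compress (Subtype.val : T → FockIndex m) ρ.op).trace.re := fun ρ hρ => by
    have h := le_trace_compress ρ (ne_top_of_le_ne_top hμ hρ) K T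
      fun k hk => hT (mem_boundedFock.2 hk)
    have h1 : (meanPhotonNumber ρ).toReal / (K + 1) ≤ 1 / 10 ^ 4 := by
      rw [div_le_iff₀ (by positivity)]
      have h2 := ENNReal.toReal_mono hμ hρ
      have h3 := Nat.lt_floor_add_one (P.maxMeanPhotonNumber.toReal * 10 ^ 4)
      rw [← hK] at h3
      linarith
    linarith
  have hA : ∀ x, meanPhotonNumber (P.alice x) ≤ P.maxMeanPhotonNumber := fun x =>
    (le_iSup (fun x => meanPhotonNumber (P.alice x)) x).trans (le_max_left _ _)
  have hB : ∀ y, meanPhotonNumber (P.bob y) ≤ P.maxMeanPhotonNumber := fun y =>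
    (le_iSup (fun y => meanPhotonNumber (P.bob y)) y).trans (le_max_right _ _)
  choose s hs hs0 hsp hst using fun x =>
    exists_normalized_compress (P.alice x) T (lt_of_lt_of_le (by norm_num) (hw _ (hA x)))
  choose s' hs' hs0' hsp' hst' using fun y =>
    exists_normalized_compress (P.bob y) T (lt_of_lt_of_le (by norm_num) (hw _ (hB y)))
  obtain ⟨P', hP'⟩ := exists_qubitSMP e e _ hsp hst _ hsp' hst'
    (fun r => compress (Prod.map Subtype.val Subtype.val : T × T → FockIndex m × FockIndex m)
      (P.referee r))
    (fun r => compress_posSemidef _ (P.referee_isPositive r))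
    (compress_add_eq_one (Subtype.val_injective.prodMap Subtype.val_injective) P.referee_sum)
  refine ⟨P', fun x y => ?_⟩
  set r := !f x y
  have hsum : P.referee r + P.referee (!r) = 1 := by
    cases r
    · exact P.referee_sum
    · rw [add_comm]; exact P.referee_sum
  have ht := trace_compress_le (ρ := P.alice x) (σ := P.bob y) (P.referee_isPositive r)
    (P.referee_isPositive (!r)) hsum T T (t := 1 / 50) (by norm_num)
  have hpr : (traceTensor (P.referee r) (P.alice x) (P.bob y)).re ≤ 1 / 3 := hP x y
  have h1 := hw _ (hA x)
  have h2 := hw _ (hB y)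
  rw [hs, Complex.ofReal_re] at h1
  rw [hs', Complex.ofReal_re] at h2
  rw [hs, hs', ← Complex.ofReal_mul, Complex.ofReal_re] at ht
  rw [hP', Matrix.smul_kronecker, Matrix.kronecker_smul, smul_smul, Matrix.mul_smul,
    Matrix.trace_smul, smul_eq_mul, ← Complex.ofReal_mul, Complex.re_ofReal_mul, ← mul_inv,
    inv_mul_le_iff₀ (mul_pos (hs0 x) (hs0' y))]
  -- The bound is `(51 / 50) / 3 + 51 (1 - s s') ≤ 0.36 s s'` for `s s' ≥ (1 - 10⁻⁴)²`.
  have h3 : (1 - 1 / 10 ^ 4) * (1 - 1 / 10 ^ 4) ≤ s x * s' y :=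
    mul_le_mul h1 h2 (by norm_num) (hs0 x).le
  linarith

end OpticalComm

theorem theorem5 :
    ∃ c : ℝ, 0 < c ∧
      ∀ (f : (n : ℕ) → (Fin n → Bool) → (Fin n → Bool) → Bool) (m : ℕ → ℕ)
        (P : (n : ℕ) → OpticalComm.OpticalSMP (Fin n → Bool) (Fin n → Bool) (m n)),
        (∀ n, 2 ≤ m n) →
        (∀ n, (P n).Computes (f n) (1 / 3)) →
        (∀ n, (P n).maxMeanPhotonNumber ≠ ⊤) →
        (∀ n, c * (OpticalComm.qubitSMPComplexity (f n) (1 / 3) : ℝ) ≤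
          OpticalComm.opticalCost (1 / 10 ^ 4) (P n).maxMeanPhotonNumber.toReal (m n)) ∧
        (∀ n, c * Real.log (OpticalComm.detComplexity (f n) : ℝ) ≤
          OpticalComm.opticalCost (1 / 10 ^ 4) (P n).maxMeanPhotonNumber.toReal (m n)) := by
  -- The factor `36 = 6 · 6`: there are `6 a` qubits, and `log D` is at most `6` times as large.
  refine ⟨1 / (36 * (3 * 10 ^ 4)), by norm_num, fun f m P hm hP hμ => ?_⟩
  have key : ∀ n, ∃ (a : ℕ)
      (P' : OpticalComm.QubitSMP (Fin n → Bool) (Fin n → Bool) (3 * a) (3 * a)),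
      P'.Computes (f n) (1 / 3) ∧ (a : ℝ) ≤ 3 * 10 ^ 4 *
        OpticalComm.opticalCost (1 / 10 ^ 4) (P n).maxMeanPhotonNumber.toReal (m n) := fun n => by
    obtain ⟨P₁, hP₁⟩ := OpticalComm.exists_qubitSMP_of_opticalSMP (hm n) (P n) (hP n) (hμ n)
      (Nat.le_pow_clog (by norm_num) _)
    obtain ⟨P₂, hP₂⟩ := OpticalComm.exists_computes_of_error_le P₁ hP₁
    exact ⟨_, P₂, hP₂, OpticalComm.clog_card_boundedFock_le (hm n) ENNReal.toReal_nonneg⟩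
  refine ⟨fun n => ?_, fun n => ?_⟩ <;> obtain ⟨a, P', hP', ha⟩ := key n
  · have hQ : OpticalComm.qubitSMPComplexity (f n) (1 / 3) ≤ 3 * a + 3 * a :=
      Nat.sInf_le ⟨_, _, P', hP', rfl⟩
    have hQ' : (OpticalComm.qubitSMPComplexity (f n) (1 / 3) : ℝ) ≤ 3 * a + 3 * a := by
      exact_mod_cast hQ
    have ha0 : (0 : ℝ) ≤ a := Nat.cast_nonneg a
    linarith
  · have hD := OpticalComm.log_detComplexity_le P' hP'
    push_cast at hD
    linarith
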